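/- For $0\le a<b$, $\lambda>0$ and a continuous function $f:[a,b]\to\mathbf R$ let $$\Phi_{[a,b],\lambda}(f)=\sup_{k\ge 0}\Big(\sup_{a=t_0<t_1<\cdots<t_{k+1}=b}\ \sum_{i=1}^{k+1}|f(t_i)-f(t_{i-1})|-\lambda k\Big)$$ be the regularized total variation, and put $\Phi_{[a,a],\lambda}(f)=0$. Proposition. There are real numbers $\varepsilon_{b,\lambda,L}$ (for real $b\ge 0$, $\lambda>0$ and integers $L\ge 1$) with $$0\le\varepsilon_{b,\lambda,L}\le\lambda,$$ such that for every standard real-valued Brownian motion $\{W_t\}_{t\ge0}$ and all real $b\ge0$, $\lambda>0$ and integers $L\ge1$ the random variables $\Phi_{[0,b],\lambda}(W)$ and $\Phi_{[0,b],\lambda/\sqrt L}(W)$ are integrable and $$\mathbf E\,\Phi_{[0,b],\lambda/\sqrt L}(W)=\sqrt L\,\big(\mathbf E\,\Phi_{[0,b],\lambda}(W)-\varepsilon_{b,\lambda,L}\big).$$ -/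

import Mathlib

open MeasureTheory ProbabilityTheory
open scoped NNReal

/-- The set of partitions `a = t₀ < t₁ < ⋯ < t_{k+1} = b` of `[a, b]` with `k` interior points. -/
def partitions {T : Type*} [Preorder T] (a b : T) (k : ℕ) : Set (Fin (k + 2) → T) :=
  {t | StrictMono t ∧ t 0 = a ∧ t (Fin.last (k + 1)) = b}

/-- `∑_{i=1}^{k+1} |f(t_i) - f(t_{i-1})|`, the variation of `f` along the points `t`. -/
def variationAlong {T : Type*} (f : T → ℝ) {k : ℕ} (t : Fin (k + 2) → T) : ℝ :=
  ∑ i : Fin (k + 1), |f (t i.succ) - f (t i.castSucc)|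

/-- `TV_{[a,b],k}(f)`: the largest variation of `f` along a partition of `[a, b]` with `k` interior
points. It is `0` if there is no such partition, in particular if `a = b`. -/
noncomputable def TVk {T : Type*} [Preorder T] (a b : T) (k : ℕ) (f : T → ℝ) : ℝ :=
  sSup (variationAlong f '' partitions a b k)

/-- The regularized total variation `Φ_{[a,b],lam}(f) = sup_{k ≥ 0} (TV_{[a,b],k}(f) - lam * k)`.
For a continuous real function on a compact interval and `lam > 0` the supremum is finite. -/
noncomputable def regTV {T : Type*} [Preorder T] (a b : T) (lam : ℝ) (f : T → ℝ) : ℝ :=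
  ⨆ k : ℕ, (TVk a b k f - lam * k)

/-!
The regularized total variation is additive up to `lam`: for `a < b < c`,
`Φ_{[a,b]} + Φ_{[b,c]} - lam ≤ Φ_{[a,c]} ≤ Φ_{[a,b]} + Φ_{[b,c]}`. Joining partitions of `[a, b]`
and `[b, c]` creates one more interior point, namely `b`, which costs `lam`; conversely, adding `b` to a
partition of `[a, c]` does not decrease the variation, and `b` is not an interior point of either
part (`add_sub_le_regTV`, `regTV_le_add`).

For a Brownian motion `W` the increments over `[a, a + b]` have the law of `W` on `[0, b]`, so
`𝐄 Φ_{[0,Lb],lam}(W)` lies between `L 𝐄 Φ_{[0,b],lam}(W) - (L - 1) lam` and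
`L 𝐄 Φ_{[0,b],lam}(W)` (`integral_regTV_nat_mul`). Brownian scaling gives
`𝐄 Φ_{[0,b],lam/√L}(W) = 𝐄 Φ_{[0,Lb],lam}(W) / √L` (`integral_regTV_div_sqrt`). Hence
`ε = 𝐄 Φ_{[0,b],lam}(W) - 𝐄 Φ_{[0,Lb],lam}(W) / L` lies in `[0, lam]` and satisfies the identity.

Two points need an argument. The expectations have to depend on the law of `W` only: on continuous
functions `Φ` agrees with a measurable function of countably many coordinates, because the
partitions with `k` interior points have a countable dense subset (`exists_measurable_eq_regTV`,
`integral_regTV_eq`). And `Φ(W)` has to be integrable. For this, choose thresholds `μ n` with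
`2 ∑ μ n ≤ lam`. By dyadic chaining, an increment of a continuous `f` over `[s, t]` is at most `lam`
plus the sum over the dyadic intervals in `[s, t]` of the part of the increment exceeding the
threshold of its level. Summing over a partition, `Φ(f)` is at most `lam` plus the sum of these
excesses over all dyadic intervals of `[0, b]` (`hasVariation_le_of_summable_excess`). The excess of
an increment `x` over `μ` is at most `x ^ 4 / μ ^ 3`, and for Brownian motion the expectations of
these bounds form a convergent geometric series when `μ n` is a multiple of `(5 / 6) ^ n`
(`exists_integrable_bound`).
-/

/-! ### Partitions built one point at a time, and approximate additivity -/

lemma variationAlong_succ {T : Type*} (f : T → ℝ) {k : ℕ} (t : Fin (k + 1 + 2) → T) :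
    variationAlong f t = variationAlong f (Fin.init t : Fin (k + 2) → T) +
      |f (t (Fin.last (k + 2))) - f (t (Fin.last (k + 1)).castSucc)| := by
  simp only [variationAlong, Fin.sum_univ_castSucc (n := k + 1)]
  rfl

section Concatenation

variable {T : Type*} [LinearOrder T] {f : T → ℝ} {a b c : T} {k l : ℕ} {v w lam : ℝ}

/-- `HasVariation f a b k v` says that some partition of `[a, b]` with `k` interior points has
variation `v` along `f`. The partition is built from left to right, which replaces manipulations
of functions on `Fin (k + 2)` by induction; see `mem_image_variationAlong_iff`. -/
inductive HasVariation (f : T → ℝ) (a : T) : T → ℕ → ℝ → Prop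
  | single {b : T} (hab : a < b) : HasVariation f a b 0 |f b - f a|
  | snoc {b c : T} {k : ℕ} {v : ℝ} (h : HasVariation f a b k v) (hbc : b < c) :
      HasVariation f a c (k + 1) (v + |f c - f b|)

theorem mem_image_variationAlong_iff :
    v ∈ variationAlong f '' partitions a b k ↔ HasVariation f a b k v := by
  constructor
  · rintro ⟨t, ⟨ht, rfl, rfl⟩, rfl⟩
    induction k with
    | zero =>
      have h : variationAlong f t = |f (t 1) - f (t 0)| := by simp [variationAlong]
      rw [h]
      exact .single (ht (by simp))
    | succ k ih =>
      rw [variationAlong_succ]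
      refine .snoc (ih (t := Fin.init t) fun i j hij ↦ ht (by simpa using hij)) (ht ?_)
      exact Fin.castSucc_lt_last _
  · intro h
    induction h with
    | @single b hab =>
      refine ⟨![a, b], ⟨?_, rfl, rfl⟩, by simp [variationAlong]⟩
      rw [Fin.strictMono_iff_lt_succ]
      simpa using hab
    | @snoc b c k v h hbc ih =>
      obtain ⟨t, ⟨ht, h0, hl⟩, rfl⟩ := ih
      refine ⟨Fin.snoc (α := fun _ ↦ T) t c, ⟨?_, ?_, ?_⟩, ?_⟩
      · rw [Fin.strictMono_iff_lt_succ]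
        intro i
        induction i using Fin.lastCases with
        | last => rw [Fin.succ_last, Fin.snoc_last, Fin.snoc_castSucc, hl]; exact hbc
        | cast i =>
          rw [Fin.succ_castSucc, Fin.snoc_castSucc, Fin.snoc_castSucc]
          exact ht (Fin.castSucc_lt_succ)
      · rw [← h0, ← Fin.castSucc_zero, Fin.snoc_castSucc]
      · simp
      · rw [variationAlong_succ, Fin.init_snoc, Fin.snoc_last, Fin.snoc_castSucc, hl]

theorem image_variationAlong_partitions :
    variationAlong f '' partitions a b k = {v | HasVariation f a b k v} :=
  Set.ext fun _ ↦ mem_image_variationAlong_iff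

lemma HasVariation.lt (h : HasVariation f a b k v) : a < b := by
  induction h with
  | single hab => exact hab
  | snoc _ hbc ih => exact ih.trans hbc

lemma HasVariation.concat (h : HasVariation f a b k v) (h' : HasVariation f b c l w) :
    HasVariation f a c (k + l + 1) (v + w) := by
  induction h' with
  | single hbc => exact .snoc h hbc
  | snoc _ hcd ih => rw [← add_assoc v]; exact .snoc ih hcd

/-- Adding the point `b` to a partition of `[a, c]` does not decrease the variation, and the
interior points of the two parts are among those of the original partition. -/
lemma HasVariation.split (h : HasVariation f a c k v) (hab : a < b) (hbc : b < c) :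
    ∃ k₁ k₂ v₁ v₂, HasVariation f a b k₁ v₁ ∧ HasVariation f b c k₂ v₂ ∧
      k₁ + k₂ ≤ k ∧ v ≤ v₁ + v₂ := by
  induction h with
  | @single c hac =>
    refine ⟨0, 0, _, _, .single hab, .single hbc, le_rfl, ?_⟩
    rw [add_comm]
    exact abs_sub_le _ _ _
  | @snoc d c k v h hdc ih =>
    rcases lt_trichotomy b d with hbd | rfl | hdb
    · obtain ⟨k₁, k₂, v₁, v₂, h₁, h₂, hk, hv⟩ := ih hbd
      exact ⟨k₁, k₂ + 1, v₁, _, h₁, .snoc h₂ hdc, by omega, by linarith⟩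
    · exact ⟨k, 0, v, _, h, .single hbc, by omega, le_rfl⟩
    · refine ⟨k + 1, 0, _, _, .snoc h hdb, .single hbc, le_rfl, ?_⟩
      linarith [abs_sub_le (f c) (f b) (f d)]

/-- The family whose supremum defines `regTV a b lam f` is bounded above, so that `regTV a b lam
f` is a genuine supremum and not the value `0` of an unbounded one. -/
def RegTVBddAbove (a b : T) (lam : ℝ) (f : T → ℝ) : Prop :=
  ∃ M : ℝ, ∀ k v, HasVariation f a b k v → v - lam * k ≤ M

lemma regTV_self (hlam : 0 ≤ lam) : regTV a a lam f = 0 := by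
  have h (k : ℕ) : TVk a a k f = 0 := by
    have : {v | HasVariation f a a k v} = ∅ :=
      Set.eq_empty_of_forall_notMem fun v hv ↦ lt_irrefl a hv.lt
    rw [TVk, image_variationAlong_partitions, this, Real.sSup_empty]
  simp only [regTV, h, zero_sub]
  refine le_antisymm (ciSup_le fun k ↦ ?_) (le_ciSup_of_le ⟨0, ?_⟩ 0 (by simp))
  · have : 0 ≤ lam * k := by positivity
    linarith
  · rintro _ ⟨k, rfl⟩
    have : 0 ≤ lam * k := by positivity
    dsimp only
    linarith

/-- The hypothesis `0 ≤ M` covers the case in which there are no partitions and `TVk` is `0`. -/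
lemma TVk_sub_le {M : ℝ} (hlam : 0 ≤ lam) (hM : 0 ≤ M)
    (h : ∀ k v, HasVariation f a b k v → v - lam * k ≤ M) (k : ℕ) :
    TVk a b k f - lam * k ≤ M := by
  have hk : 0 ≤ lam * k := by positivity
  have : TVk a b k f ≤ M + lam * k := by
    rw [TVk, image_variationAlong_partitions]
    exact Real.sSup_le (fun v hv ↦ by linarith [h k v hv]) (by linarith)
  linarith

lemma regTV_le {M : ℝ} (hlam : 0 ≤ lam) (hM : 0 ≤ M)
    (h : ∀ k v, HasVariation f a b k v → v - lam * k ≤ M) : regTV a b lam f ≤ M :=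
  ciSup_le fun k ↦ TVk_sub_le hlam hM h k

lemma RegTVBddAbove.bddAbove_range (hlam : 0 ≤ lam) (h : RegTVBddAbove a b lam f) :
    BddAbove (Set.range fun k : ℕ ↦ TVk a b k f - lam * k) := by
  obtain ⟨M, hM⟩ := h
  refine ⟨max M 0, ?_⟩
  rintro _ ⟨k, rfl⟩
  exact TVk_sub_le hlam (le_max_right _ _) (fun k v hv ↦ (hM k v hv).trans (le_max_left _ _)) k

lemma le_regTV (hlam : 0 ≤ lam) (h : RegTVBddAbove a b lam f) (hv : HasVariation f a b k v) :
    v - lam * k ≤ regTV a b lam f := by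
  refine le_trans ?_ (le_ciSup (h.bddAbove_range hlam) k)
  obtain ⟨M, hM⟩ := h
  rw [TVk, image_variationAlong_partitions]
  refine sub_le_sub_right (le_csSup ⟨M + lam * k, fun w hw ↦ ?_⟩ hv) _
  linarith [hM k w hw]

lemma regTV_nonneg (hlam : 0 ≤ lam) (h : RegTVBddAbove a b lam f) : 0 ≤ regTV a b lam f := by
  refine le_ciSup_of_le (h.bddAbove_range hlam) 0 ?_
  have : 0 ≤ TVk a b 0 f :=
    Real.sSup_nonneg fun x hx ↦ by
      obtain ⟨t, -, rfl⟩ := hx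
      exact Finset.sum_nonneg fun _ _ ↦ abs_nonneg _
  simpa using this

lemma RegTVBddAbove.left (h : RegTVBddAbove a c lam f) (hbc : b < c) :
    RegTVBddAbove a b lam f := by
  obtain ⟨M, hM⟩ := h
  refine ⟨M + lam, fun k v hv ↦ ?_⟩
  have := hM _ _ (.snoc hv hbc)
  push_cast at this
  linarith [abs_nonneg (f c - f b)]

lemma RegTVBddAbove.right (h : RegTVBddAbove a c lam f) (hab : a < b) :
    RegTVBddAbove b c lam f := by
  obtain ⟨M, hM⟩ := h
  refine ⟨M + lam, fun k v hv ↦ ?_⟩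
  have := hM _ _ (HasVariation.concat (.single hab) hv)
  push_cast at this
  linarith [abs_nonneg (f b - f a)]

theorem regTV_le_add (hlam : 0 ≤ lam) (h : RegTVBddAbove a c lam f) (hab : a < b) (hbc : b < c) :
    regTV a c lam f ≤ regTV a b lam f + regTV b c lam f := by
  have h₁ := h.left hbc
  have h₂ := h.right hab
  refine regTV_le hlam (add_nonneg (regTV_nonneg hlam h₁) (regTV_nonneg hlam h₂)) fun k v hv ↦ ?_
  obtain ⟨k₁, k₂, v₁, v₂, hv₁, hv₂, hk, hle⟩ := hv.split hab hbc
  have hk' : (k₁ : ℝ) + k₂ ≤ k := by exact_mod_cast hk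
  have := mul_le_mul_of_nonneg_left hk' hlam
  linarith [le_regTV hlam h₁ hv₁, le_regTV hlam h₂ hv₂]

theorem add_sub_le_regTV (hlam : 0 ≤ lam) (h : RegTVBddAbove a c lam f) (hab : a < b)
    (hbc : b < c) :
    regTV a b lam f + regTV b c lam f - lam ≤ regTV a c lam f := by
  set R := regTV a c lam f
  -- Bound the joined partitions, then pass to the supremum over the left part and the right part.
  have hcat {k l v w} (hv : HasVariation f a b k v) (hw : HasVariation f b c l w) :
      (v - lam * k) + (w - lam * l) ≤ R + lam := by
    have := le_regTV hlam h (hv.concat hw)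
    push_cast at this
    linarith
  have hfirst {l w} (hw : HasVariation f b c l w) :
      regTV a b lam f ≤ R + lam - (w - lam * l) := by
    refine regTV_le hlam ?_ fun k v hv ↦ by linarith [hcat hv hw]
    have := hcat (.single hab) hw
    simp only [Nat.cast_zero, mul_zero, sub_zero] at this
    linarith [abs_nonneg (f b - f a)]
  have hsecond : regTV b c lam f ≤ R + lam - regTV a b lam f := by
    refine regTV_le hlam ?_ fun l w hw ↦ by linarith [hfirst hw]
    have := hfirst (.single hbc)
    simp only [Nat.cast_zero, mul_zero, sub_zero] at this
    linarith [abs_nonneg (f c - f b)]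
  linarith

end Concatenation

/-! ### Shifts and scaling -/

section Transformations

open scoped Pointwise

variable {f : ℝ≥0 → ℝ} {a b : ℝ≥0} {k : ℕ} {v lam : ℝ}

lemma regTV_congr {g : ℝ≥0 → ℝ} {a' b' : ℝ≥0}
    (h : ∀ k v, HasVariation f a b k v ↔ HasVariation g a' b' k v) :
    regTV a b lam f = regTV a' b' lam g := by
  simp only [regTV, TVk, image_variationAlong_partitions, h]

theorem regTV_shift (f : ℝ≥0 → ℝ) (a b : ℝ≥0) (lam : ℝ) :
    regTV a (a + b) lam f = regTV 0 b lam (fun t ↦ f (a + t) - f a) := by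
  set g : ℝ≥0 → ℝ := fun t ↦ f (a + t) - f a
  have h₁ {c k v} (h : HasVariation f a c k v) : HasVariation g 0 (c - a) k v := by
    induction h with
    | @single c hac =>
      have : |f c - f a| = |g (c - a) - g 0| := by simp [g, add_tsub_cancel_of_le hac.le]
      rw [this]
      exact .single (tsub_pos_of_lt hac)
    | @snoc c d k v hv hcd ih =>
      have : |f d - f c| = |g (d - a) - g (c - a)| := by
        simp [g, add_tsub_cancel_of_le hv.lt.le, add_tsub_cancel_of_le (hv.lt.trans hcd).le]
      rw [this]
      exact .snoc ih (tsub_lt_tsub_right_of_le hv.lt.le hcd)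
  have h₂ {c k v} (h : HasVariation g 0 c k v) : HasVariation f a (a + c) k v := by
    induction h with
    | @single c hc =>
      have : |g c - g 0| = |f (a + c) - f a| := by simp [g]
      rw [this]
      exact .single (by simpa using hc)
    | @snoc c d k v hv hcd ih =>
      have : |g d - g c| = |f (a + d) - f (a + c)| := by simp [g]
      rw [this]
      exact .snoc ih (by simpa using hcd)
  exact regTV_congr fun k v ↦ ⟨fun h ↦ by simpa using h₁ h, h₂⟩

lemma HasVariation.scale {r : ℝ} (hr : 0 ≤ r) {s : ℝ≥0} (hs : 0 < s)
    (h : HasVariation f a b k v) :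
    HasVariation (fun t ↦ r * f (s * t)) (s⁻¹ * a) (s⁻¹ * b) k (r * v) := by
  have key (x y : ℝ≥0) : r * |f y - f x| =
      |(fun t ↦ r * f (s * t)) (s⁻¹ * y) - (fun t ↦ r * f (s * t)) (s⁻¹ * x)| := by
    simp only [mul_inv_cancel_left₀ hs.ne', ← mul_sub, abs_mul, abs_of_nonneg hr]
  induction h with
  | single hab =>
    rw [key]
    exact .single (mul_lt_mul_of_pos_left hab (by positivity))
  | snoc h hbc ih =>
    rw [mul_add, key]
    exact .snoc ih (mul_lt_mul_of_pos_left hbc (by positivity))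

theorem regTV_scale (f : ℝ≥0 → ℝ) (b : ℝ≥0) (lam : ℝ) {r : ℝ} (hr : 0 < r) {s : ℝ≥0}
    (hs : 0 < s) :
    regTV 0 b (r * lam) (fun t ↦ r * f (s * t)) = r * regTV 0 (s * b) lam f := by
  have h (k : ℕ) : {v | HasVariation (fun t ↦ r * f (s * t)) 0 b k v} =
      r • {v | HasVariation f 0 (s * b) k v} := by
    ext v
    rw [Set.mem_smul_set_iff_inv_smul_mem₀ hr.ne']
    simp only [Set.mem_ofPred_eq, smul_eq_mul]
    constructor
    · intro hv
      have := hv.scale (inv_nonneg.2 hr.le) (inv_pos.2 hs)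
      simpa [inv_mul_cancel_left₀ hr.ne', mul_inv_cancel_left₀ hs.ne'] using this
    · intro hv
      have := hv.scale hr.le hs
      simpa [mul_inv_cancel_left₀ hr.ne', inv_mul_cancel_left₀ hs.ne'] using this
  simp only [regTV, TVk, image_variationAlong_partitions, h, Real.mul_iSup_of_nonneg hr.le,
    Real.sSup_smul_of_nonneg hr.le, smul_eq_mul, mul_sub, mul_assoc]

end Transformations

/-! ### Dyadic chaining -/

section Chaining

open Finset Filter Topology

/-- The amount by which the increment of `g` over the `k`-th grid interval of level `n` exceeds
the threshold `μ n`. Here `g n k` stands for the value of a function at the `k`-th grid point of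
level `n`. -/
def excess (μ : ℕ → ℝ) (g : ℕ → ℕ → ℝ) (n k : ℕ) : ℝ :=
  max (|g n (k + 1) - g n k| - μ n) 0

/-- The sum of the excesses over the grid intervals of levels `0, …, n` whose right endpoint is at
most the `x`-th grid point of level `n`. Halving `x` rounds it down to the next coarser grid. -/
def excessUpTo (μ : ℕ → ℝ) (g : ℕ → ℕ → ℝ) : ℕ → ℕ → ℝ
  | 0, x => ∑ k ∈ range x, excess μ g 0 k
  | n + 1, x => ∑ k ∈ range x, excess μ g (n + 1) k + excessUpTo μ g n (x / 2)

variable {μ : ℕ → ℝ} {g : ℕ → ℕ → ℝ}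

lemma excess_nonneg (μ : ℕ → ℝ) (g : ℕ → ℕ → ℝ) (n k : ℕ) : 0 ≤ excess μ g n k :=
  le_max_right _ _

lemma monotone_sum_range_excess (n : ℕ) :
    Monotone fun x ↦ ∑ k ∈ range x, excess μ g n k := fun _ _ h ↦
  sum_le_sum_of_subset_of_nonneg (range_mono h) fun _ _ _ ↦ excess_nonneg ..

lemma monotone_excessUpTo (n : ℕ) : Monotone (excessUpTo μ g n) := by
  induction n with
  | zero => exact monotone_sum_range_excess 0
  | succ n ih =>
    exact (monotone_sum_range_excess (n + 1)).add fun _ _ h ↦ ih (Nat.div_le_div_right h)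

lemma excessUpTo_nonneg (n x : ℕ) : 0 ≤ excessUpTo μ g n x := by
  induction n generalizing x with
  | zero => exact sum_nonneg fun _ _ ↦ excess_nonneg ..
  | succ n ih => exact add_nonneg (sum_nonneg fun _ _ ↦ excess_nonneg ..) (ih _)

lemma excessUpTo_two_pow (n : ℕ) :
    excessUpTo μ g n (2 ^ n) = ∑ m ∈ range (n + 1), ∑ k ∈ range (2 ^ m), excess μ g m k := by
  induction n with
  | zero => simp [excessUpTo]
  | succ n ih => rw [sum_range_succ, ← ih, excessUpTo, pow_succ, Nat.mul_div_cancel _ two_pos,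
      add_comm]

lemma abs_sub_le_of_le_succ (hμ : ∀ n, 0 ≤ μ n) (n : ℕ) {x y : ℕ} (hxy : x ≤ y) (hyx : y ≤ x + 1) :
    |g n y - g n x| ≤
      μ n + (∑ k ∈ range y, excess μ g n k - ∑ k ∈ range x, excess μ g n k) := by
  obtain rfl | rfl : y = x ∨ y = x + 1 := by omega
  · simpa using hμ n
  · rw [sum_range_succ, add_sub_cancel_left]
    linarith [show |g n (x + 1) - g n x| - μ n ≤ excess μ g n x from le_max_left _ _]

/-- The chaining bound. The `i`-th and `j`-th grid points of level `n` are rounded to the next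
coarser grid, inwards, so that each level contributes at most two grid intervals, both contained
in `[i, j]`. The right side is additive in `[i, j]` up to the sum of the thresholds, which is what
makes it summable along a partition. -/
theorem abs_sub_le_chaining (hμ : ∀ n, 0 ≤ μ n) (hg : ∀ n k, g (n + 1) (2 * k) = g n k)
    (n : ℕ) {i j : ℕ} (hij : i ≤ j) (hj : j ≤ 2 ^ n) :
    |g n j - g n i| ≤
      2 * ∑ m ∈ range (n + 1), μ m + (excessUpTo μ g n j - excessUpTo μ g n i) := by
  induction n generalizing i j with
  | zero =>
    have := abs_sub_le_of_le_succ (g := g) hμ 0 hij (by simp at hj; omega)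
    simp only [excessUpTo, zero_add, sum_range_one]
    linarith [hμ 0]
  | succ n ih =>
    rcases hij.eq_or_lt with rfl | hlt
    · simpa using sum_nonneg fun m _ ↦ hμ m
    -- The grid points of level `n` next to `i` and `j` inside `[i, j]`.
    obtain ⟨i', hi'⟩ : ∃ i', i' = (i + 1) / 2 := ⟨_, rfl⟩
    obtain ⟨j', hj'⟩ : ∃ j', j' = j / 2 := ⟨_, rfl⟩
    have h₁ := abs_sub_le_of_le_succ (g := g) hμ (n + 1) (x := i) (y := 2 * i')
      (by omega) (by omega)
    have h₂ := abs_sub_le_of_le_succ (g := g) hμ (n + 1) (x := 2 * j') (y := j)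
      (by omega) (by omega)
    have h₃ := ih (i := i') (j := j') (by omega) (by rw [pow_succ] at hj; omega)
    have h₄ : excessUpTo μ g n (i / 2) ≤ excessUpTo μ g n i' := monotone_excessUpTo n (by omega)
    have h₅ : ∑ k ∈ range (2 * i'), excess μ g (n + 1) k ≤
        ∑ k ∈ range (2 * j'), excess μ g (n + 1) k := monotone_sum_range_excess _ (by omega)
    have h₆ := abs_add_three (g (n + 1) j - g (n + 1) (2 * j'))
      (g (n + 1) (2 * j') - g (n + 1) (2 * i')) (g (n + 1) (2 * i') - g (n + 1) i)
    rw [sub_add_sub_cancel, sub_add_sub_cancel] at h₆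
    rw [hg] at h₁ h₂
    simp only [hg] at h₆
    rw [sum_range_succ _ (n + 1)]
    simp only [excessUpTo, ← hj']
    linarith

lemma sum_fin_sub_castSucc (G : ℕ → ℝ) {m : ℕ} (x : Fin (m + 1) → ℕ) :
    ∑ i : Fin m, (G (x i.succ) - G (x i.castSucc)) = G (x (Fin.last m)) - G (x 0) := by
  induction m with
  | zero => simp
  | succ m ih =>
    have := ih fun i ↦ x i.castSucc
    rw [Fin.sum_univ_castSucc, Fin.succ_last]
    simp only [Fin.succ_castSucc, this, Fin.castSucc_zero]
    ring

lemma tendsto_floor_mul_div {b : ℝ≥0} (hb : 0 < b) (t : ℝ≥0) :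
    Tendsto (fun n : ℕ ↦ (⌊t * (2 ^ n / b)⌋₊ : ℝ≥0) * (b / 2 ^ n)) atTop (𝓝 t) := by
  have h : Tendsto (fun n : ℕ ↦ (2 : ℝ) ^ n / b) atTop atTop :=
    (tendsto_pow_atTop_atTop_of_one_lt one_lt_two).atTop_div_const (by exact_mod_cast hb)
  have := (tendsto_nat_floor_mul_div_atTop t.coe_nonneg).comp h
  rw [← NNReal.tendsto_coe]
  refine this.congr fun n ↦ ?_
  have : ⌊t * (2 ^ n / b)⌋₊ = ⌊(t : ℝ) * (2 ^ n / b)⌋₊ := by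
    refine eq_of_forall_le_iff fun m ↦ ?_
    rw [Nat.le_floor_iff zero_le, Nat.le_floor_iff (by positivity), ← NNReal.coe_le_coe]
    simp
  rw [Function.comp_apply, ← this]
  simp [div_eq_mul_inv]

/-- A bound, uniform over all partitions of `[0, b]`, for the penalized variation of a continuous
function by the excesses of its dyadic increments. -/
theorem hasVariation_le_of_summable_excess {f : ℝ≥0 → ℝ} (hf : Continuous f) {b : ℝ≥0}
    {lam : ℝ} (hμ : ∀ n, 0 ≤ μ n) (hμlam : ∀ n, 2 * ∑ m ∈ range n, μ m ≤ lam)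
    (hs : Summable fun n ↦ ∑ k ∈ range (2 ^ n), excess μ (fun n k ↦ f (k * (b / 2 ^ n))) n k)
    {k : ℕ} {v : ℝ} (hv : HasVariation f 0 b k v) :
    v - lam * k ≤
      lam + ∑' n, ∑ k ∈ range (2 ^ n), excess μ (fun n k ↦ f (k * (b / 2 ^ n))) n k := by
  set g : ℕ → ℕ → ℝ := fun n k ↦ f (k * (b / 2 ^ n)) with hgdef
  have hb : 0 < b := hv.lt
  have hg (n k : ℕ) : g (n + 1) (2 * k) = g n k := by
    simp only [hgdef]
    congr 1
    push_cast
    field_simp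
    ring
  obtain ⟨t, ⟨ht, h0, hl⟩, rfl⟩ := mem_image_variationAlong_iff.2 hv
  -- Round the partition down to the grid of level `n` and let `n` tend to infinity.
  let x (n : ℕ) (i : Fin (k + 2)) : ℕ := ⌊t i * (2 ^ n / b)⌋₊
  have hx (n : ℕ) : Monotone (x n) := fun i j hij ↦
    Nat.floor_mono (by gcongr; exact ht.monotone hij)
  have hxl (n : ℕ) : x n (Fin.last (k + 1)) = 2 ^ n := by
    have : b * (2 ^ n / b) = ((2 ^ n : ℕ) : ℝ≥0) := by push_cast; field_simp
    simp only [x, hl, this, Nat.floor_natCast]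
  have hlim : Tendsto (fun n ↦ ∑ i : Fin (k + 1), |g n (x n i.succ) - g n (x n i.castSucc)|)
      atTop (𝓝 (variationAlong f t)) := by
    refine tendsto_finsetSum _ fun i _ ↦ (Tendsto.sub ?_ ?_).abs <;>
      exact (hf.tendsto _).comp (tendsto_floor_mul_div hb _)
  have hbound (n : ℕ) : ∑ i : Fin (k + 1), |g n (x n i.succ) - g n (x n i.castSucc)| ≤
      (k + 1) * lam + ∑' n, ∑ k ∈ range (2 ^ n), excess μ g n k := by
    have hstep (i : Fin (k + 1)) : |g n (x n i.succ) - g n (x n i.castSucc)| ≤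
        lam + (excessUpTo μ g n (x n i.succ) - excessUpTo μ g n (x n i.castSucc)) := by
      refine (abs_sub_le_chaining hμ hg n (hx n Fin.castSucc_lt_succ.le) ?_).trans
        (add_le_add_left (hμlam _) _)
      rw [← hxl n]
      exact hx n (Fin.le_last _)
    refine (sum_le_sum fun i _ ↦ hstep i).trans ?_
    rw [sum_add_distrib, sum_fin_sub_castSucc, hxl, excessUpTo_two_pow]
    have h₁ := hs.sum_le_tsum (range (n + 1))
      fun n _ ↦ sum_nonneg fun k _ ↦ excess_nonneg μ g n k
    have h₂ := excessUpTo_nonneg (μ := μ) (g := g) n (x n 0)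
    simp only [sum_const, card_univ, Fintype.card_fin, nsmul_eq_mul]
    push_cast
    linarith
  linarith [le_of_tendsto' hlim hbound]

end Chaining

/-! ### Measurability and dependence on the law -/

section Measurability

open Set

/-- On continuous functions `regTV a b lam` is a measurable function of countably many
coordinates. -/
theorem exists_measurable_eq_regTV (a b : ℝ≥0) (lam : ℝ) :
    ∃ G : (ℝ≥0 → ℝ) → ℝ, Measurable G ∧ (∀ f, Continuous f → G f = regTV a b lam f) ∧
      ∃ D : Set ℝ≥0, D.Countable ∧ ∀ f g, EqOn f g D → G f = G g := by
  choose S hSc hSd using fun k ↦ TopologicalSpace.exists_countable_dense (partitions a b k)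
  have (k : ℕ) : Countable (S k) := (hSc k).to_subtype
  refine ⟨fun f ↦ ⨆ k : ℕ, ((⨆ t : S k, variationAlong f t.1.1) - lam * k), ?_, fun f hf ↦ ?_,
    ⋃ k, ⋃ t ∈ S k, range t.1, ?_, fun f g hfg ↦ ?_⟩
  · unfold variationAlong
    exact .iSup fun k ↦ (Measurable.iSup fun t ↦ by fun_prop).sub_const _
  · simp only [regTV, TVk, sSup_image']
    congr! 3 with k
    refine (hSd k).ciSup' (f := fun t : partitions a b k ↦ variationAlong f t.1) ?_
    have h (i) : Continuous fun t : partitions a b k ↦ f (t.1 i) :=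
      hf.comp ((continuous_apply i).comp continuous_subtype_val)
    exact continuous_finsetSum _ fun i _ ↦ ((h _).sub (h _)).abs
  · exact countable_iUnion fun k ↦ (hSc k).biUnion fun t _ ↦ countable_range _
  · refine iSup_congr fun k ↦ congrArg (· - lam * k) (iSup_congr fun t ↦ ?_)
    have h (i) : f (t.1.1 i) = g (t.1.1 i) :=
      hfg (mem_iUnion_of_mem k (mem_biUnion t.2 (mem_range_self i)))
    simp only [variationAlong, h]

variable {Ω Ω' : Type*} [MeasurableSpace Ω] [MeasurableSpace Ω'] {P : Measure Ω} {P' : Measure Ω'}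
  {W : ℝ≥0 → Ω → ℝ} {W' : ℝ≥0 → Ω' → ℝ}

/-- All coordinates are assumed measurable, and not only almost everywhere measurable, because the
index set of the product is uncountable. -/
lemma map_eq_of_isPreBrownianReal (hW : IsPreBrownianReal W P) (hW' : IsPreBrownianReal W' P')
    (hm : ∀ t, Measurable (W t)) (hm' : ∀ t, Measurable (W' t)) :
    P.map (fun ω t ↦ W t ω) = P'.map (fun ω t ↦ W' t ω) := by
  have h := isProjectiveLimit_map (measurable_pi_lambda _ hm).aemeasurable (P := P)
  have h' := isProjectiveLimit_map (measurable_pi_lambda _ hm').aemeasurable (P := P')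
  simp only [(hW.hasLaw _).map_eq] at h
  simp only [(hW'.hasLaw _).map_eq] at h'
  exact h.unique h'

/-- The process `V` is taken to be a modification of `W` with measurable coordinates; its paths
need not be continuous. -/
theorem exists_regTV_ae_eq (hW : IsBrownianReal W P) {a b : ℝ≥0} {lam : ℝ}
    {G : (ℝ≥0 → ℝ) → ℝ} (hGc : ∀ f, Continuous f → G f = regTV a b lam f)
    {D : Set ℝ≥0} (hD : D.Countable) (hGD : ∀ f g, EqOn f g D → G f = G g) :
    ∃ V : ℝ≥0 → Ω → ℝ, IsPreBrownianReal V P ∧ (∀ t, Measurable (V t)) ∧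
      (fun ω ↦ regTV a b lam (fun t ↦ W t ω)) =ᵐ[P] fun ω ↦ G (fun t ↦ V t ω) := by
  have hm := hW.aemeasurable
  refine ⟨fun t ↦ (hm t).mk, hW.congr fun t ↦ (hm t).ae_eq_mk, fun t ↦ (hm t).measurable_mk, ?_⟩
  filter_upwards [hW.cont, (ae_ball_iff hD).2 fun t _ ↦ (hm t).ae_eq_mk] with ω hc hω
  rw [← hGc _ hc]
  exact hGD _ _ hω

theorem integral_regTV_eq (hW : IsBrownianReal W P) (hW' : IsBrownianReal W' P') (a b : ℝ≥0)
    (lam : ℝ) :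
    ∫ ω, regTV a b lam (fun t ↦ W t ω) ∂P = ∫ ω, regTV a b lam (fun t ↦ W' t ω) ∂P' := by
  obtain ⟨G, hG, hGc, D, hD, hGD⟩ := exists_measurable_eq_regTV a b lam
  obtain ⟨V, hV, hVm, hVe⟩ := exists_regTV_ae_eq hW hGc hD hGD
  obtain ⟨V', hV', hVm', hVe'⟩ := exists_regTV_ae_eq hW' hGc hD hGD
  rw [integral_congr_ae hVe, integral_congr_ae hVe',
    ← integral_map (φ := fun ω t ↦ V t ω) (measurable_pi_lambda _ hVm).aemeasurable
      hG.aestronglyMeasurable,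
    ← integral_map (φ := fun ω t ↦ V' t ω) (measurable_pi_lambda _ hVm').aemeasurable
      hG.aestronglyMeasurable, map_eq_of_isPreBrownianReal hV hV' hVm hVm']

theorem aestronglyMeasurable_regTV (hW : IsBrownianReal W P) (a b : ℝ≥0) (lam : ℝ) :
    AEStronglyMeasurable (fun ω ↦ regTV a b lam (fun t ↦ W t ω)) P := by
  obtain ⟨G, hG, hGc, D, hD, hGD⟩ := exists_measurable_eq_regTV a b lam
  obtain ⟨V, -, hVm, hVe⟩ := exists_regTV_ae_eq hW hGc hD hGD
  exact (hG.comp (measurable_pi_lambda _ hVm)).aestronglyMeasurable.congr hVe.symm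

end Measurability

/-! ### Integrability -/

section Integrability

open Finset

variable {Ω : Type*} [MeasurableSpace Ω] {P : Measure Ω} {W : ℝ≥0 → Ω → ℝ}

lemma integral_pow_four_gaussianReal (h : ℝ≥0) :
    ∫ x, x ^ 4 ∂gaussianReal 0 h = (h : ℝ) ^ 2 * ∫ x, x ^ 4 ∂gaussianReal 0 1 := by
  have : gaussianReal 0 h = (gaussianReal 0 1).map (√h * ·) := by
    rw [gaussianReal_map_const_mul]
    congr 1
    · simp
    · ext
      simp
  rw [this, integral_map (by fun_prop) (by fun_prop), ← integral_const_mul]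
  refine integral_congr_ae (.of_forall fun x ↦ ?_)
  have : √(h : ℝ) ^ 4 = (h : ℝ) ^ 2 := by
    rw [show 4 = 2 * 2 from rfl, pow_mul, Real.sq_sqrt h.coe_nonneg]
  simp only [mul_pow, this]

lemma integrable_pow_four_gaussianReal (h : ℝ≥0) :
    Integrable (fun x ↦ x ^ 4) (gaussianReal 0 h) := by
  have := (memLp_id_gaussianReal (μ := 0) (v := h) 4).integrable_norm_pow (by norm_num)
  simpa [Even.pow_abs (by decide : Even 4)] using this

lemma max_abs_sub_le_pow_four_div {c : ℝ} (hc : 0 < c) (x : ℝ) :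
    max (|x| - c) 0 ≤ x ^ 4 / c ^ 3 := by
  rw [← Even.pow_abs (by decide : Even 4) x]
  have hx := abs_nonneg x
  generalize |x| = y at hx
  refine max_le ?_ (by positivity)
  rw [le_div_iff₀ (by positivity)]
  rcases le_total y c with h | h
  · have : (y - c) * c ^ 3 ≤ 0 := mul_nonpos_of_nonpos_of_nonneg (by linarith) (by positivity)
    have : 0 ≤ y ^ 4 := by positivity
    linarith
  · calc (y - c) * c ^ 3 ≤ y * y ^ 3 := by gcongr; linarith
      _ = y ^ 4 := by ring

lemma integrable_excess_integral_le {μ : ℕ → ℝ} (hμ : ∀ n, 0 < μ n) (hW : IsBrownianReal W P)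
    (b : ℝ≥0) (n : ℕ) :
    Integrable (fun ω ↦
      ∑ k ∈ range (2 ^ n), excess μ (fun n k ↦ W (k * (b / 2 ^ n)) ω) n k) P ∧
    ∫ ω, ∑ k ∈ range (2 ^ n), excess μ (fun n k ↦ W (k * (b / 2 ^ n)) ω) n k ∂P ≤
      2 ^ n * ((b / 2 ^ n) ^ 2 * (∫ x, x ^ 4 ∂gaussianReal 0 1) / μ n ^ 3) := by
  set h : ℝ≥0 := b / 2 ^ n with hh
  have hlaw (k : ℕ) : HasLaw (W ((k + 1 : ℕ) * h) - W (k * h)) (gaussianReal 0 h) P := by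
    have hdist : nndist (((k + 1 : ℕ) * h : ℝ≥0) : ℝ) ((k * h : ℝ≥0) : ℝ) = h := by
      rw [← NNReal.coe_inj, coe_nndist, Real.dist_eq]
      push_cast
      rw [show ((k : ℝ) + 1) * h - k * h = h by ring, NNReal.abs_eq]
    convert hW.hasLaw_sub ((k + 1 : ℕ) * h) (k * h) using 2
    exact hdist.symm
  have hint (k : ℕ) : Integrable (fun ω ↦ (W ((k + 1 : ℕ) * h) - W (k * h)) ω ^ 4) P := by
    have := integrable_pow_four_gaussianReal h
    rw [← (hlaw k).map_eq] at this
    exact this.comp_aemeasurable (hlaw k).aemeasurable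
  have hval (k : ℕ) : ∫ ω, (W ((k + 1 : ℕ) * h) - W (k * h)) ω ^ 4 ∂P =
      (h : ℝ) ^ 2 * ∫ x, x ^ 4 ∂gaussianReal 0 1 := by
    rw [← integral_pow_four_gaussianReal]
    exact (hlaw k).integral_comp (f := fun x ↦ x ^ 4) (by fun_prop)
  have hle (k : ℕ) (ω : Ω) : excess μ (fun n k ↦ W (k * (b / 2 ^ n)) ω) n k ≤
      (W ((k + 1 : ℕ) * h) - W (k * h)) ω ^ 4 / μ n ^ 3 := max_abs_sub_le_pow_four_div (hμ n) _
  have hexc (k : ℕ) : Integrable (fun ω ↦ excess μ (fun n k ↦ W (k * (b / 2 ^ n)) ω) n k) P := by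
    refine ((hint k).div_const (μ n ^ 3)).mono' ?_ (.of_forall fun ω ↦ ?_)
    · unfold excess
      have := hW.aemeasurable
      have : AEMeasurable (fun ω ↦
          max (|W ((k + 1 : ℕ) * (b / 2 ^ n)) ω - W (k * (b / 2 ^ n)) ω| - μ n) 0) P := by
        refine AEMeasurable.max (AEMeasurable.sub_const ?_ _) aemeasurable_const
        exact continuous_abs.measurable.comp_aemeasurable ((this _).sub (this _))
      exact this.aestronglyMeasurable
    · rw [Real.norm_of_nonneg (excess_nonneg ..)]
      exact hle k ω
  refine ⟨integrable_finsetSum _ fun k _ ↦ hexc k, ?_⟩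
  rw [integral_finsetSum _ fun k _ ↦ hexc k]
  have hb (k : ℕ) : ∫ ω, excess μ (fun n k ↦ W (k * (b / 2 ^ n)) ω) n k ∂P ≤
      (h : ℝ) ^ 2 * (∫ x, x ^ 4 ∂gaussianReal 0 1) / μ n ^ 3 := by
    rw [← hval k, ← integral_div]
    exact integral_mono (hexc k) ((hint k).div_const _) fun ω ↦ hle k ω
  refine (sum_le_card_nsmul _ _ _ fun k _ ↦ hb k).trans_eq ?_
  simp [hh]

/-- The penalized variations of a Brownian path over all partitions of `[0, b]` have an integrable
common bound. -/
theorem exists_integrable_bound (hW : IsBrownianReal W P) (b : ℝ≥0) {lam : ℝ} (hlam : 0 < lam) :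
    ∃ M : Ω → ℝ, Integrable M P ∧ (∀ ω, 0 ≤ M ω) ∧ ∀ᵐ ω ∂P, ∀ k v,
      HasVariation (fun t ↦ W t ω) 0 b k v → v - lam * k ≤ M ω := by
  have : IsProbabilityMeasure P := hW.isGaussianProcess.isProbabilityMeasure
  set m := ∫ x, x ^ 4 ∂gaussianReal 0 1
  -- The thresholds are summable with total `lam / 2`, and since `(5 / 6) ^ 3 > 1 / 2` the expected
  -- excesses are summable as well.
  set μ : ℕ → ℝ := fun n ↦ lam / 12 * (5 / 6) ^ n with hμdef
  have hμ (n : ℕ) : 0 < μ n := by positivity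
  have hμlam (n : ℕ) : 2 * ∑ m ∈ range n, μ m ≤ lam := by
    rw [← mul_sum, geom_sum_eq (by norm_num),
      show ((5 / 6 : ℝ) ^ n - 1) / (5 / 6 - 1) = 6 - 6 * (5 / 6) ^ n by ring]
    have : 0 ≤ lam * (5 / 6 : ℝ) ^ n := by positivity
    linarith
  set Y : ℕ → Ω → ℝ := fun n ω ↦
    ∑ k ∈ range (2 ^ n), excess μ (fun n k ↦ W (k * (b / 2 ^ n)) ω) n k
  have hY0 (n : ℕ) (ω : Ω) : 0 ≤ Y n ω := sum_nonneg fun _ _ ↦ excess_nonneg ..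
  have hYi (n : ℕ) : Integrable (Y n) P := (integrable_excess_integral_le hμ hW b n).1
  have hYle (n : ℕ) : ∫ ω, Y n ω ∂P ≤ (b ^ 2 * m / (lam / 12) ^ 3) * (108 / 125) ^ n := by
    refine (integrable_excess_integral_le hμ hW b n).2.trans_eq ?_
    have h₁ : (108 / 125 : ℝ) ^ n = ((6 / 5) ^ n) ^ 3 / 2 ^ n := by
      rw [← pow_mul, mul_comm, pow_mul, ← div_pow]; norm_num
    have h₂ : (5 / 6 : ℝ) ^ n = ((6 / 5) ^ n)⁻¹ := by rw [← inv_pow]; norm_num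
    simp only [hμdef]
    rw [h₁, h₂]
    field_simp
    rfl
  have hlint : ∫⁻ ω, ∑' n, ENNReal.ofReal (Y n ω) ∂P ≠ ⊤ := by
    rw [lintegral_tsum fun n ↦ (hYi n).aemeasurable.ennreal_ofReal]
    have hsum : Summable fun n : ℕ ↦ (b ^ 2 * m / (lam / 12) ^ 3) * (108 / 125 : ℝ) ^ n :=
      (summable_geometric_of_lt_one (by norm_num) (by norm_num)).mul_left _
    refine ne_top_of_le_ne_top hsum.tsum_ofReal_ne_top (ENNReal.tsum_le_tsum fun n ↦ ?_)
    rw [← ofReal_integral_eq_lintegral_ofReal (hYi n) (.of_forall (hY0 n))]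
    exact ENNReal.ofReal_le_ofReal (hYle n)
  have hmeas : AEMeasurable (fun ω ↦ ∑' n, ENNReal.ofReal (Y n ω)) P :=
    .tsum fun n ↦ (hYi n).aemeasurable.ennreal_ofReal
  refine ⟨fun ω ↦ lam + (∑' n, ENNReal.ofReal (Y n ω)).toReal,
    (integrable_const lam).add (integrable_toReal_of_lintegral_ne_top hmeas hlint),
    fun ω ↦ by positivity, ?_⟩
  filter_upwards [hW.cont, ae_lt_top' hmeas hlint] with ω hc hω k v hv
  have hs : Summable fun n ↦ Y n ω := by
    have := ENNReal.summable_toReal hω.ne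
    simpa only [ENNReal.toReal_ofReal (hY0 _ ω)] using this
  refine (hasVariation_le_of_summable_excess hc (fun n ↦ (hμ n).le) hμlam hs hv).trans_eq ?_
  rw [ENNReal.tsum_toReal_eq fun n ↦ ENNReal.ofReal_ne_top]
  exact congrArg (lam + ·) (tsum_congr fun n ↦ (ENNReal.toReal_ofReal (hY0 n ω)).symm)

theorem ae_regTVBddAbove (hW : IsBrownianReal W P) (b : ℝ≥0) {lam : ℝ} (hlam : 0 < lam) :
    ∀ᵐ ω ∂P, RegTVBddAbove 0 b lam (fun t ↦ W t ω) := by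
  obtain ⟨M, -, -, hM⟩ := exists_integrable_bound hW b hlam
  filter_upwards [hM] with ω hω using ⟨M ω, hω⟩

theorem integrable_regTV (hW : IsBrownianReal W P) (b : ℝ≥0) {lam : ℝ} (hlam : 0 < lam) :
    Integrable (fun ω ↦ regTV 0 b lam (fun t ↦ W t ω)) P := by
  obtain ⟨M, hMi, hM0, hM⟩ := exists_integrable_bound hW b hlam
  refine hMi.mono' (aestronglyMeasurable_regTV hW 0 b lam) ?_
  filter_upwards [hM] with ω hω
  rw [Real.norm_of_nonneg (regTV_nonneg hlam.le ⟨M ω, hω⟩)]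
  exact regTV_le hlam.le (hM0 ω) hω

end Integrability

/-! ### Expectations over long intervals and Brownian scaling -/

section Expectation

variable {Ω : Type*} [MeasurableSpace Ω] {P : Measure Ω} {W : ℝ≥0 → Ω → ℝ}

theorem integral_regTV_add (hW : IsBrownianReal W P) (a b : ℝ≥0) {lam : ℝ} (hlam : 0 < lam)
    (ha : 0 < a) :
    ∫ ω, regTV 0 (a + b) lam (fun t ↦ W t ω) ∂P ≤
        (∫ ω, regTV 0 a lam (fun t ↦ W t ω) ∂P) + ∫ ω, regTV 0 b lam (fun t ↦ W t ω) ∂P ∧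
      (∫ ω, regTV 0 a lam (fun t ↦ W t ω) ∂P) + (∫ ω, regTV 0 b lam (fun t ↦ W t ω) ∂P) - lam ≤
        ∫ ω, regTV 0 (a + b) lam (fun t ↦ W t ω) ∂P := by
  have : IsProbabilityMeasure P := hW.isGaussianProcess.isProbabilityMeasure
  rcases eq_zero_or_pos b with rfl | hb
  · simp [regTV_self hlam.le, hlam.le]
  have hab : a < a + b := lt_add_of_pos_right a hb
  have hi := integrable_regTV hW (a + b) hlam
  have hi₁ := integrable_regTV hW a hlam
  have hi₂ : Integrable (fun ω ↦ regTV a (a + b) lam (fun t ↦ W t ω)) P := by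
    simp only [regTV_shift]
    exact integrable_regTV (hW.shift a) b hlam
  have heq : ∫ ω, regTV 0 b lam (fun t ↦ W t ω) ∂P =
      ∫ ω, regTV a (a + b) lam (fun t ↦ W t ω) ∂P := by
    simp only [regTV_shift]
    exact integral_regTV_eq hW (hW.shift a) 0 b lam
  have hbdd := ae_regTVBddAbove hW (a + b) hlam
  rw [heq]
  constructor
  · rw [← integral_add hi₁ hi₂]
    refine integral_mono_ae hi (hi₁.add hi₂) ?_
    filter_upwards [hbdd] with ω hω using regTV_le_add hlam.le hω ha hab
  · rw [← integral_add hi₁ hi₂, sub_le_iff_le_add,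
      show (∫ ω, regTV 0 (a + b) lam (fun t ↦ W t ω) ∂P) + lam =
        ∫ ω, regTV 0 (a + b) lam (fun t ↦ W t ω) + lam ∂P by
          rw [integral_add hi (integrable_const _)]; simp]
    refine integral_mono_ae (hi₁.add hi₂) (hi.add (integrable_const _)) ?_
    filter_upwards [hbdd] with ω hω using
      sub_le_iff_le_add.1 (add_sub_le_regTV hlam.le hω ha hab)

theorem integral_regTV_nat_mul (hW : IsBrownianReal W P) (b : ℝ≥0) {lam : ℝ} (hlam : 0 < lam)
    {L : ℕ} (hL : 1 ≤ L) :
    ∫ ω, regTV 0 (L * b) lam (fun t ↦ W t ω) ∂P ≤ L * ∫ ω, regTV 0 b lam (fun t ↦ W t ω) ∂P ∧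
      L * (∫ ω, regTV 0 b lam (fun t ↦ W t ω) ∂P) - (L - 1) * lam ≤
        ∫ ω, regTV 0 (L * b) lam (fun t ↦ W t ω) ∂P := by
  rcases eq_zero_or_pos b with rfl | hb
  · simp only [mul_zero, regTV_self hlam.le, integral_zero, le_refl, true_and, zero_sub,
      Left.neg_nonpos_iff]
    exact mul_nonneg (by simpa using hL) hlam.le
  induction L, hL using Nat.le_induction with
  | base => simp
  | succ L hL ih =>
    have hpos : 0 < (L : ℝ≥0) * b := mul_pos (by exact_mod_cast hL) hb
    have h := integral_regTV_add hW (L * b) b hlam hpos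
    rw [Nat.cast_succ, add_one_mul]
    push_cast
    constructor <;> linarith [h.1, h.2, ih.1, ih.2]

/-- Brownian scaling: the process `t ↦ W (L t) / √L` is again a Brownian motion. -/
theorem integral_regTV_div_sqrt (hW : IsBrownianReal W P) (b : ℝ≥0) (lam : ℝ) {L : ℕ}
    (hL : 1 ≤ L) :
    ∫ ω, regTV 0 b (lam / √(L : ℝ)) (fun t ↦ W t ω) ∂P =
      (√(L : ℝ))⁻¹ * ∫ ω, regTV 0 (L * b) lam (fun t ↦ W t ω) ∂P := by
  have hL₀ : (0 : ℝ≥0) < L := by exact_mod_cast hL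
  have hL₁ : (0 : ℝ) < (√(L : ℝ))⁻¹ := inv_pos.2 (Real.sqrt_pos.2 (by exact_mod_cast hL))
  rw [integral_regTV_eq hW (hW.smul hL₀.ne'), ← integral_const_mul]
  rw [div_eq_inv_mul]
  exact integral_congr_ae (.of_forall fun ω ↦ regTV_scale (fun t ↦ W t ω) b lam hL₁ hL₀)

end Expectation

theorem mainTheorem9 :
    ∃ ε : ℝ≥0 → ℝ → ℕ → ℝ,
      (∀ (b : ℝ≥0) (lam : ℝ) (L : ℕ), 0 < lam → 1 ≤ L →
        0 ≤ ε b lam L ∧ ε b lam L ≤ lam) ∧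
      ∀ (Ω : Type*) [MeasurableSpace Ω] (P : Measure Ω) (W : ℝ≥0 → Ω → ℝ),
        IsBrownianReal W P →
        ∀ (b : ℝ≥0) (lam : ℝ) (L : ℕ), 0 < lam → 1 ≤ L →
          Integrable (fun ω ↦ regTV 0 b lam (fun t ↦ W t ω)) P ∧
          Integrable (fun ω ↦ regTV 0 b (lam / √(L : ℝ)) (fun t ↦ W t ω)) P ∧
          ∫ ω, regTV 0 b (lam / √(L : ℝ)) (fun t ↦ W t ω) ∂P =
            √(L : ℝ) * ((∫ ω, regTV 0 b lam (fun t ↦ W t ω) ∂P) - ε b lam L) := by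
  -- The numbers `ε` are read off from one Brownian motion in the universe at hand; as the
  -- expectations depend on the law only, they serve for all others.
  by_cases hex : ∃ (Ω : Type _) (_ : MeasurableSpace Ω) (P : Measure Ω) (W : ℝ≥0 → Ω → ℝ),
    IsBrownianReal W P
  swap
  · exact ⟨0, fun _ _ _ hlam _ ↦ ⟨le_rfl, hlam.le⟩,
      fun Ω _ P W hW ↦ (hex ⟨Ω, _, P, W, hW⟩).elim⟩
  obtain ⟨Ω₀, _, P₀, W₀, hW₀⟩ := hex
  refine ⟨fun b lam L ↦ (∫ ω, regTV 0 b lam (fun t ↦ W₀ t ω) ∂P₀) -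
      (∫ ω, regTV 0 (L * b) lam (fun t ↦ W₀ t ω) ∂P₀) / L, fun b lam L hlam hL ↦ ?_,
    fun Ω _ P W hW b lam L hlam hL ↦ ?_⟩
  · have hL₀ : (0 : ℝ) < L := by exact_mod_cast hL
    obtain ⟨h₁, h₂⟩ := integral_regTV_nat_mul hW₀ b hlam hL
    rw [sub_nonneg, div_le_iff₀ hL₀, sub_le_comm, le_div_iff₀ hL₀]
    constructor <;> linarith
  · have hL₀ : 0 < √(L : ℝ) := Real.sqrt_pos.2 (by exact_mod_cast hL)
    refine ⟨integrable_regTV hW b hlam, integrable_regTV hW b (div_pos hlam hL₀), ?_⟩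
    rw [integral_regTV_div_sqrt hW b lam hL, integral_regTV_eq hW hW₀ 0 b lam,
      integral_regTV_eq hW hW₀ 0 (L * b) lam, sub_sub_cancel]
    have hL₁ : (L : ℝ) ≠ 0 := by positivity
    field_simp
    rw [Real.sq_sqrt (Nat.cast_nonneg L), mul_comm]
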